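/- Let $1\le p\le q$ be integers and let $N\ge 0$ be an integer. Put $r=(q-p+1)/2$ and $h=(q+p-1)/2$. For integers $m_1>\dots>m_p\ge 0$ write $m=(m_1,\dots,m_p)$ and $$A_N(m)=\prod_{j=1}^p\frac{(2m_j-p+q+1)\,\bigl((q-p+m_j)!\bigr)^2}{(m_j!)^2\,\Gamma(N+q+m_j+1)\,\Gamma(N+p-m_j)} .$$ For $s=(s_1,\dots,s_p)\in\mathbb C^p$ with pairwise distinct squares $s_j^2$, let $\Phi_s$ denote the spherical function given by the Berezin–Karpelevich formula $$\Phi_s(x)=c\cdot\frac{\det_{k,j}\bigl\{{}_2F_1(r+s_j,\,r-s_j;\,q-p+1;\,-x_k)\bigr\}}{\prod_{1\le k<l\le p}(s_k^2-s_l^2)\ \prod_{1\le k<l\le p}(x_k-x_l)},$$ extended by continuity to points where some of the $x_k$ coincide, the constant $c$ being fixed by $\Phi_s(0)=1$. Then for all $x=(x_1,\dots,x_p)\in\mathbb C^p$: $$\prod_{j=1}^p(1+x_j)^N\prod_{1\le k<l\le p}(x_k-x_l)=\frac{\prod_{j=1}^p\Gamma(N+j)^2}{\Gamma(q-p+1)^{p}}\sum_{N+p-1\ge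 m_1>\dots>m_p\ge0}\Bigl\{A_N(m)\prod_{1\le k<l\le p}(m_k-m_l)(m_k+m_l+q-p+1)\Bigr\}\det_{j,l}\bigl\{{}_2F_1(-m_j,\,q-p+1+m_j;\,q-p+1;\,-x_l)\bigr\}$$ and $$\prod_{j=1}^p(1+x_j)^N=\prod_{j=1}^p\frac{\Gamma(N+j)^2}{\Gamma(j)\,\Gamma(q-p+j)}\sum_{N+p-1\ge m_1>\dots>m_p\ge0}\Bigl\{A_N(m)\prod_{1\le k<l\le p}(m_k-m_l)^2(m_k+m_l+q-p+1)^2\Bigr\}\,\Phi_{p-h-m_1-1,\dots,p-h-m_p-1}(x_1,\dots,x_p).$$ -/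

import Mathlib

noncomputable section

/-- The half-sum shift `r = (q - p + 1) / 2`. -/
def rParam (p q : ℕ) : ℂ := ((q : ℂ) - p + 1) / 2

/-- The number `h = (q + p - 1) / 2`. -/
def hParam (p q : ℕ) : ℂ := ((q : ℂ) + p - 1) / 2

/-- The Berezin–Karpelevich quotient
`det {₂F₁(r + s_j, r - s_j; q - p + 1; -x_k)} / (∏_{k<l} (s_k² - s_l²) ∏_{k<l} (x_k - x_l))`,
meaningful when the `x_k` are pairwise distinct (and so are the `s_k²`). -/
def berezinKarpelevichQuotient (p q : ℕ) (s x : Fin p → ℂ) : ℂ :=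
  (Matrix.of fun k j : Fin p =>
      ₂F₁ (rParam p q + s j) (rParam p q - s j) ((q : ℂ) - p + 1) (-x k)).det /
    ((∏ k, ∏ l ∈ Finset.Ioi k, (s k ^ 2 - s l ^ 2)) *
      ∏ k, ∏ l ∈ Finset.Ioi k, (x k - x l))

/-- The Berezin–Karpelevich quotient, extended by continuity to the points where some of the
coordinates `x_k` coincide. -/
def berezinKarpelevich (p q : ℕ) (s : Fin p → ℂ) : (Fin p → ℂ) → ℂ :=
  extendFrom {x : Fin p → ℂ | Function.Injective x} (berezinKarpelevichQuotient p q s)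

/-- The spherical function `Φ_s` as a function of the radial coordinates `x₁, …, x_p`, given by the
Berezin–Karpelevich formula. The constant in that formula is fixed by `Φ_s(0) = 1`, since a
spherical function takes the value `1` at the base point `x = 0` of the symmetric space.
(`₂F₁` is the sum of the hypergeometric series. When, for every `j`, one of `r ± s_j` is a
nonpositive integer, all the series terminate, `₂F₁` is a polynomial in `x_k`, and the formula is
valid for all `x`.) -/
def sphericalPhi (p q : ℕ) (s x : Fin p → ℂ) : ℂ :=
  berezinKarpelevich p q s x / berezinKarpelevich p q s 0

/-- The one-variable factor of the expansion coefficients: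
`(2m - p + q + 1) ((q-p+m)!)² / ((m!)² Γ(N+q+m+1) Γ(N+p-m))`. -/
def coeffFactor (p q N m : ℕ) : ℂ :=
  (2 * (m : ℂ) - p + q + 1) * ((q - p + m).factorial : ℂ) ^ 2 /
    ((m.factorial : ℂ) ^ 2 * Complex.Gamma ((N : ℂ) + q + m + 1) * Complex.Gamma ((N : ℂ) + p - m))

end

noncomputable section
open Finset Matrix Polynomial

/-! ### The Cauchy–Binet formula -/

/-! Put `a = q - p`, `P_m(x) = ₂F₁(-m, a+1+m; a+1; -x)` and `λ_m = m(m+a+1)`. The determinant of the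
powers `(1 + x_l)^(N+p-1-i)` is `∏ (1 + x_j)^N ∏_{k<l} (x_k - x_l)`. Expanding each power in the
`P_m` (`one_add_pow_eq_sum`) makes this matrix a product, and Cauchy–Binet gives a sum over
decreasing `m` of a coefficient minor times `det P_{m_j}(x_l)`. Up to constants, row `i` of the
minor is a monic polynomial of degree `i` in `-λ_m` times a factor common to its column, so the
minor is a Vandermonde determinant (`det_expCoeff`). This is the first identity.

For the second, `det P_{m_j}(x_l)` is the Vandermonde determinant of `x` times a determinant of
divided differences, continuous in `x`. At `x = 0` the latter is the determinant of the coefficients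
of the `P_{m_j}`, again a Vandermonde determinant in `λ`; this normalizes `Φ_s` (`sphericalPhi_eq`).
Cancelling `∏ (x_k - x_l)` at distinct coordinates and using density finishes the proof. -/

theorem exists_strictAnti_comp_perm {p : ℕ} {K : Type*} [LinearOrder K] {f : Fin p → K}
    (hf : Function.Injective f) :
    ∃ g : Fin p → K, StrictAnti g ∧ ∃ σ : Equiv.Perm (Fin p), g ∘ σ = f := by
  have hmono : StrictMono (f ∘ Tuple.sort f) :=
    (Tuple.monotone_sort f).strictMono_of_injective (hf.comp (Tuple.sort f).injective)
  refine ⟨f ∘ Tuple.sort f ∘ Fin.rev, fun i j hij => hmono (Fin.rev_lt_rev.2 hij),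
    (Tuple.sort f)⁻¹.trans Fin.revPerm, ?_⟩
  ext i
  simp

theorem strictAnti_comp_perm_injective {p : ℕ} {K : Type*} [LinearOrder K] {g g' : Fin p → K}
    (hg : StrictAnti g) (hg' : StrictAnti g') {σ σ' : Equiv.Perm (Fin p)}
    (h : g ∘ σ = g' ∘ σ') : g = g' ∧ σ = σ' := by
  have hgt : ∀ i, g i = g' (σ' (σ⁻¹ i)) := fun i => by
    simpa using congrFun h (σ⁻¹ i)
  -- An increasing permutation of `Fin p` is the identity.
  have hmono : StrictMono fun i => σ' (σ⁻¹ i) := fun i j hij => by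
    have := hg hij
    rw [hgt, hgt] at this
    exact hg'.lt_iff_gt.1 this
  have hid : (fun i => σ' (σ⁻¹ i)) = id := by
    refine (hmono.range_inj strictMono_id).1 ?_
    rw [Set.range_id]
    exact (σ'.surjective.comp (σ⁻¹).surjective).range_eq
  refine ⟨funext fun i => (hgt i).trans (congrArg g' (congrFun hid i)), ?_⟩
  ext i
  have := congrFun hid (σ i)
  simp at this
  rw [this]

/-- Multilinearity in the rows gives a sum over all `f : Fin p → K`. Non-injective `f` repeat a row
and vanish; an injective `f` is uniquely `g ∘ σ` with `g` decreasing, and summing over `σ` rebuilds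
the minor of `A`. -/
theorem Matrix.det_mul_eq_sum_strictAnti {R : Type*} [CommRing R] {p : ℕ} {K : Type*}
    [Fintype K] [LinearOrder K] [DecidablePred (StrictAnti : (Fin p → K) → Prop)]
    (A : Matrix (Fin p) K R) (B : Matrix K (Fin p) R) :
    (A * B).det = ∑ g : Fin p → K with StrictAnti g,
      (A.submatrix id g).det * (B.submatrix g id).det := by
  classical
  have hexp : (A * B).det = ∑ f : Fin p → K, (∏ i, A i (f i)) * (B.submatrix f id).det := by
    have h1 : A * B = fun i => ∑ k : K, A i k • B k := by
      ext i l
      simp [Matrix.mul_apply]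
    have h2 := (detRowAlternating (n := Fin p) (R := R)).toMultilinearMap.map_sum
      (fun i (k : K) => A i k • B k)
    rw [h1]
    refine h2.trans (sum_congr rfl fun f _ => ?_)
    exact (detRowAlternating (n := Fin p) (R := R)).toMultilinearMap.map_smul_univ
      (fun i => A i (f i)) (fun i => B (f i))
  have hprod : ∀ g : Fin p → K, (A.submatrix id g).det * (B.submatrix g id).det =
      ∑ σ : Equiv.Perm (Fin p), (∏ i, A i (g (σ i))) * (B.submatrix (g ∘ σ) id).det := by
    intro g
    rw [← Matrix.det_transpose, Matrix.det_apply', sum_mul]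
    refine sum_congr rfl fun σ _ => ?_
    have : (B.submatrix (g ∘ σ) id) = (B.submatrix g id).submatrix σ id := rfl
    rw [this, Matrix.det_permute]
    simp only [Matrix.transpose_apply, Matrix.submatrix_apply, id]
    ring
  rw [hexp, sum_congr rfl fun g _ => hprod g, ← sum_product']
  symm
  refine sum_of_injOn (fun gσ => gσ.1 ∘ gσ.2) ?_ (fun _ _ => mem_univ _) ?_ (fun _ _ => rfl)
  · rintro ⟨g, σ⟩ hg ⟨g', σ'⟩ hg' h
    simp only [coe_product, coe_filter, mem_univ, true_and, Set.mem_prod, Set.mem_ofPred_eq] at hg hg'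
    obtain ⟨rfl, rfl⟩ := strictAnti_comp_perm_injective hg.1 hg'.1 h
    rfl
  · intro f _ hf
    have : ¬ Function.Injective f := fun hinj => hf <| by
      obtain ⟨g, hg, σ, rfl⟩ := exists_strictAnti_comp_perm hinj
      exact ⟨(g, σ), by simpa using hg, rfl⟩
    obtain ⟨i, j, hij, hne⟩ : ∃ i j, f i = f j ∧ i ≠ j := by
      simpa [Function.Injective] using this
    rw [Matrix.det_zero_of_row_eq hne (by ext l; simp [hij]), mul_zero]

/-! ### Newton's divided differences of a polynomial -/

/-- The quotient of `f` by `(X - x 0) ⋯ (X - x (i - 1))`. -/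
def newtonQuotient {R : Type*} [CommRing R] (f : R[X]) (x : ℕ → R) : ℕ → R[X]
  | 0 => f
  | i + 1 => newtonQuotient f x i /ₘ (X - C (x i))

/-- The divided difference `f[x 0, …, x i]`. -/
def dividedDifference {R : Type*} [CommRing R] (f : R[X]) (x : ℕ → R) (i : ℕ) : R :=
  (newtonQuotient f x i).eval (x i)

section
variable {R S : Type*} [CommRing R] [CommRing S]

theorem newtonQuotient_eq_add (f : R[X]) (x : ℕ → R) (i : ℕ) :
    newtonQuotient f x i =
      C (dividedDifference f x i) + (X - C (x i)) * newtonQuotient f x (i + 1) := by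
  conv_lhs => rw [← modByMonic_add_div (newtonQuotient f x i) (X - C (x i)),
    modByMonic_X_sub_C_eq_C_eval]
  rfl

theorem eq_sum_dividedDifference_add (f : R[X]) (x : ℕ → R) (n : ℕ) :
    f = ∑ i ∈ range n, C (dividedDifference f x i) * ∏ u ∈ range i, (X - C (x u)) +
      (∏ u ∈ range n, (X - C (x u))) * newtonQuotient f x n := by
  induction n with
  | zero => simp [newtonQuotient]
  | succ n ih =>
    conv_lhs => rw [ih, newtonQuotient_eq_add]
    rw [sum_range_succ, prod_range_succ]
    ring

theorem eval_eq_sum_dividedDifference (f : R[X]) (x : ℕ → R) {n k : ℕ} (hk : k < n) :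
    f.eval (x k) = ∑ i ∈ range n,
      (∏ u ∈ range i, (X - C (x u))).eval (x k) * dividedDifference f x i := by
  conv_lhs => rw [eq_sum_dividedDifference_add f x n]
  rw [eval_add, eval_mul, eval_prod, prod_eq_zero (mem_range.2 hk) (by simp), zero_mul, add_zero,
    eval_finsetSum]
  simp [mul_comm]

theorem newtonQuotient_map (φ : R →+* S) (f : R[X]) (x : ℕ → R) (i : ℕ) :
    newtonQuotient (f.map φ) (φ ∘ x) i = (newtonQuotient f x i).map φ := by
  induction i with
  | zero => rfl
  | succ i ih =>
    rw [newtonQuotient, newtonQuotient, ih, Polynomial.map_divByMonic φ (monic_X_sub_C _)]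
    simp

theorem dividedDifference_map (φ : R →+* S) (f : R[X]) (x : ℕ → R) (i : ℕ) :
    dividedDifference (f.map φ) (φ ∘ x) i = φ (dividedDifference f x i) := by
  rw [dividedDifference, dividedDifference, newtonQuotient_map, Function.comp_apply,
    eval_map_apply]

theorem coeff_newtonQuotient_zero (f : R[X]) (i n : ℕ) :
    (newtonQuotient f (fun _ => 0) i).coeff n = f.coeff (n + i) := by
  induction i generalizing n with
  | zero => rfl
  | succ i ih =>
    have := ih (n + 1)
    rw [newtonQuotient_eq_add] at this
    simp only [C_0, sub_zero, coeff_add, coeff_C_succ, zero_add, coeff_X_mul] at this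
    rw [this]
    congr 1
    ring

theorem dividedDifference_zero (f : R[X]) (i : ℕ) :
    dividedDifference f (fun _ => 0) i = f.coeff i := by
  rw [dividedDifference, ← coeff_zero_eq_eval_zero, coeff_newtonQuotient_zero, zero_add]

/-- The extension of a finite tuple by zero. -/
def extendZero {p : ℕ} (x : Fin p → R) (n : ℕ) : R := if h : n < p then x ⟨n, h⟩ else 0

theorem extendZero_apply {p : ℕ} (x : Fin p → R) (k : Fin p) : extendZero x k = x k := by
  simp [extendZero]

theorem extendZero_zero {p : ℕ} : extendZero (0 : Fin p → R) = fun _ => 0 := by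
  ext n
  simp [extendZero]

/-- The determinant of the divided differences `f_j[x_0, …, x_i]`. -/
def dividedDifferenceDet {p : ℕ} (f : Fin p → R[X]) (x : Fin p → R) : R :=
  (Matrix.of fun i j : Fin p => dividedDifference (f j) (extendZero x) i).det

/-- Newton interpolation factors the matrix: values of the monic Newton basis at the nodes, times
divided differences. The Vandermonde factor splits off without assuming distinct nodes. -/
theorem det_eval_eq_vandermonde_mul {p : ℕ} (f : Fin p → R[X]) (x : Fin p → R) :
    (Matrix.of fun k j : Fin p => (f j).eval (x k)).det =
      (vandermonde x).det * dividedDifferenceDet f x := by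
  nontriviality R
  rw [det_eval_matrixOfPolynomials_eq_det_vandermonde x
    (fun i => ∏ u ∈ range i, (X - C (extendZero x u)))
    (fun i => by simp [natDegree_prod_of_monic _ _ fun u _ => monic_X_sub_C (extendZero x u)])
    (fun i => monic_prod_of_monic _ _ fun u _ => monic_X_sub_C _),
    dividedDifferenceDet, ← Matrix.det_mul]
  congr 1
  ext k j
  rw [Matrix.mul_apply, Matrix.of_apply, ← extendZero_apply x k,
    eval_eq_sum_dividedDifference (f j) (extendZero x) k.2]
  refine (Finset.sum_range _).trans ?_
  simp [extendZero_apply]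

theorem dividedDifferenceDet_zero {p : ℕ} (f : Fin p → R[X]) :
    dividedDifferenceDet f 0 = (Matrix.of fun i j : Fin p => (f j).coeff i).det := by
  simp only [dividedDifferenceDet, extendZero_zero, dividedDifference_zero]

end

theorem continuous_dividedDifference_extendZero {p : ℕ} (f : ℂ[X]) (i : ℕ) :
    Continuous fun x : Fin p → ℂ => dividedDifference f (extendZero x) i := by
  -- The divided difference at indeterminate nodes is a polynomial in them, and it specializes to
  -- every `x`.
  have h : ∀ x : Fin p → ℂ, dividedDifference f (extendZero x) i = MvPolynomial.eval x
      (dividedDifference (f.map MvPolynomial.C) (extendZero MvPolynomial.X) i) := fun x => by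
    rw [← dividedDifference_map, Polynomial.map_map]
    congr 1
    · rw [show (MvPolynomial.eval x).comp MvPolynomial.C = RingHom.id ℂ by ext; simp,
        Polynomial.map_id]
    · ext n
      by_cases hn : n < p <;> simp [extendZero, hn]
  simp only [h]
  exact MvPolynomial.continuous_eval _

theorem continuous_dividedDifferenceDet {p : ℕ} (f : Fin p → ℂ[X]) :
    Continuous (dividedDifferenceDet f) :=
  Continuous.matrix_det <| continuous_matrix fun _ _ =>
    continuous_dividedDifference_extendZero _ _

/-! ### The terminating hypergeometric polynomials and the expansion of `(1 + x) ^ M` -/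

/-- The coefficient of `x ^ n` in `₂F₁(-m, a + 1 + m; a + 1; -x)`. -/
def hypCoeff (a m n : ℕ) : ℂ :=
  ∏ u ∈ range n, ((m : ℂ) - u) * (a + 1 + m + u) / ((a + 1 + u) * (u + 1))

/-- The polynomial `₂F₁(-m, a + 1 + m; a + 1; -x)`. -/
def hypPoly (a m : ℕ) : ℂ[X] := ∑ n ∈ range (m + 1), C (hypCoeff a m n) * X ^ n

theorem hypCoeff_eq_zero {a m n : ℕ} (h : m < n) : hypCoeff a m n = 0 :=
  prod_eq_zero (mem_range.2 h) (by simp)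

theorem natCast_add_one_add_ne_zero (a u : ℕ) : (a : ℂ) + 1 + u ≠ 0 := by
  rw [add_right_comm]
  exact_mod_cast Nat.succ_ne_zero (a + u)

theorem hypCoeff_succ (a m n : ℕ) :
    (n + 1) * (a + 1 + n) * hypCoeff a m (n + 1) =
      ((m : ℂ) - n) * (a + 1 + m + n) * hypCoeff a m n := by
  have h1 := natCast_add_one_add_ne_zero a n
  have h2 : (n : ℂ) + 1 ≠ 0 := n.cast_add_one_ne_zero
  rw [hypCoeff, prod_range_succ, ← hypCoeff]
  field_simp

theorem coeff_hypPoly (a m n : ℕ) : (hypPoly a m).coeff n = hypCoeff a m n := by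
  simp only [hypPoly, finsetSum_coeff, coeff_C_mul_X_pow, sum_ite_eq, mem_range]
  split_ifs with h
  · rfl
  · exact (hypCoeff_eq_zero (by omega)).symm

theorem ascPochhammer_eval_eq_prod (z : ℂ) (n : ℕ) :
    (ascPochhammer ℂ n).eval z = ∏ u ∈ range n, (z + u) := by
  induction n with
  | zero => simp
  | succ n ih => rw [ascPochhammer_succ_eval, ih, prod_range_succ]

theorem hypergeometric_eq_eval_hypPoly (a m : ℕ) (x : ℂ) :
    ₂F₁ (-(m : ℂ)) (a + 1 + m : ℂ) (a + 1 : ℂ) (-x) = (hypPoly a m).eval x := by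
  have hterm : ∀ n : ℕ, (((n.factorial : ℂ)⁻¹ * (ascPochhammer ℂ n).eval (-(m : ℂ)) *
      (ascPochhammer ℂ n).eval (a + 1 + m : ℂ) * ((ascPochhammer ℂ n).eval (a + 1 : ℂ))⁻¹)) •
      (-x) ^ n = hypCoeff a m n * x ^ n := fun n => by
    have hfac : (n.factorial : ℂ) = ∏ u ∈ range n, ((u : ℂ) + 1) := by
      rw [← prod_range_add_one_eq_factorial]
      push_cast
      rfl
    rw [hfac, ascPochhammer_eval_eq_prod, ascPochhammer_eval_eq_prod, ascPochhammer_eval_eq_prod,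
      hypCoeff, smul_eq_mul, ← prod_inv_distrib, ← prod_inv_distrib, ← prod_mul_distrib,
      ← prod_mul_distrib, ← prod_mul_distrib, pow_eq_prod_const, pow_eq_prod_const,
      ← prod_mul_distrib, ← prod_mul_distrib]
    refine prod_congr rfl fun u _ => ?_
    have h1 := natCast_add_one_add_ne_zero a u
    have h2 : (u : ℂ) + 1 ≠ 0 := u.cast_add_one_ne_zero
    field_simp
    ring
  rw [ordinaryHypergeometric_eq_tsum]
  simp only [hterm]
  rw [tsum_eq_sum (s := range (m + 1)) fun n hn => by
    rw [hypCoeff_eq_zero (by simpa using hn), zero_mul]]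
  simp [hypPoly, eval_finsetSum]

/-- `c(M, m) / M! ^ 2`, where `c(M, m)` is the coefficient of the `m`-th hypergeometric polynomial
in the expansion of `(1 + x) ^ M`. -/
def expCoeff (a M m : ℕ) : ℂ :=
  (2 * (m : ℂ) + a + 1) * ((a + m).factorial : ℂ) ^ 2 * M.descFactorial m /
    (a.factorial * (m.factorial : ℂ) ^ 2 * M.factorial * (a + m + M + 1).factorial)

/-- The factor on the left is `λ_{M+1} - λ_m`; the division by `M! ^ 2` in `expCoeff` leaves no
other factor. At `m = M + 1` both sides vanish. -/
theorem expCoeff_succ (a M m : ℕ) :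
    ((M : ℂ) + 1 - m) * (M + a + m + 2) * expCoeff a (M + 1) m = expCoeff a M m := by
  have hdesc : ((M : ℂ) + 1 - m) * ((M + 1).descFactorial m : ℂ) =
      (M + 1) * (M.descFactorial m : ℂ) := by
    rcases le_or_gt m (M + 1) with h | h
    · have := Nat.succ_descFactorial M m
      rw [← @Nat.cast_inj ℂ] at this
      push_cast [Nat.cast_sub h] at this
      exact this
    · rw [Nat.descFactorial_of_lt h, Nat.descFactorial_of_lt (by omega)]
      simp
  have h1 : ((a + m + (M + 1) + 1).factorial : ℂ) =
      (M + a + m + 2) * ((a + m + M + 1).factorial : ℂ) := by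
    rw [show a + m + (M + 1) + 1 = (a + m + M + 1) + 1 by ring, Nat.factorial_succ]
    push_cast
    ring
  have h2 : ((M + 1).factorial : ℂ) = (M + 1) * (M.factorial : ℂ) := by
    rw [Nat.factorial_succ]
    push_cast
    ring
  have hM : (M : ℂ) + 1 ≠ 0 := M.cast_add_one_ne_zero
  have h3 : (M : ℂ) + a + m + 2 ≠ 0 := by exact_mod_cast Nat.succ_ne_zero (M + a + m + 1)
  have hf : ∀ n : ℕ, (n.factorial : ℂ) ≠ 0 := fun n => by exact_mod_cast n.factorial_ne_zero
  have := hf a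
  have := hf m
  have := hf M
  have := hf (a + m + M + 1)
  rw [expCoeff, expCoeff, h1, h2, mul_div_assoc', div_eq_div_iff (by positivity) (by positivity)]
  linear_combination (((M : ℂ) + a + m + 2) * ((2 * (m : ℂ) + a + 1) *
    ((a + m).factorial : ℂ) ^ 2) * (a.factorial * (m.factorial : ℂ) ^ 2 * M.factorial *
      (a + m + M + 1).factorial)) * hdesc

theorem hypCoeff_self_mul_expCoeff (a M : ℕ) :
    (M.factorial : ℂ) ^ 2 * expCoeff a M M * hypCoeff a M M = 1 := by
  have hf : ∀ n : ℕ, (n.factorial : ℂ) ≠ 0 := fun n => by exact_mod_cast n.factorial_ne_zero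
  -- Closed form of the coefficients of `P_M`, with denominators cleared; only `n = M` is used.
  have key : ∀ n ≤ M, hypCoeff a M n * ((M - n).factorial * (a + M).factorial *
      (a + n).factorial * n.factorial) = M.factorial * (a + M + n).factorial * a.factorial := by
    intro n
    induction n with
    | zero => intro; simp [hypCoeff]
    | succ n ih =>
      intro hn
      have h1 := ih (by omega)
      have h2 := hypCoeff_succ a M n
      obtain ⟨d, rfl⟩ := Nat.exists_eq_add_of_lt hn
      rw [show n + d + 1 - n = d + 1 by omega] at h1
      rw [show n + d + 1 - (n + 1) = d by omega]
      simp only [← add_assoc a, Nat.factorial_succ] at h1 ⊢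
      push_cast at h1 h2 ⊢
      have h3 : ((a + n + d + 1 + (n + 1)).factorial : ℂ) =
          (a + n + d + 1 + n + 1) * ((a + n + d + 1 + n).factorial : ℂ) := by
        rw [← add_assoc, Nat.factorial_succ]
        push_cast
        ring
      rw [h3]
      linear_combination ((d.factorial : ℂ) * ((a + n + d + 1) * (a + n + d).factorial) *
        (a + n).factorial * n.factorial) * h2 + ((a : ℂ) + n + d + 1 + n + 1) * h1
  have h := key M le_rfl
  have h1 : ((a + M + M + 1).factorial : ℂ) = (2 * M + a + 1) * ((a + M + M).factorial : ℂ) := by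
    rw [Nat.factorial_succ]
    push_cast
    ring
  have h2 : (2 * M + a + 1 : ℂ) ≠ 0 := by exact_mod_cast Nat.succ_ne_zero (2 * M + a)
  have := hf a
  have := hf M
  have := hf (a + M + M)
  have := hf (a + M)
  simp only [Nat.sub_self, Nat.factorial_zero, Nat.cast_one, one_mul] at h
  rw [expCoeff, h1, Nat.descFactorial_self]
  field_simp
  refine mul_left_cancel₀ (hf M) ?_
  linear_combination h

/-- Induction on `M`, and for each `M` descending induction on `n` from the top degree, where only
the term `m = M` survives. -/
theorem sum_expCoeff_mul_hypCoeff (a M n : ℕ) :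
    ∑ m ∈ range (M + 1), (M.factorial : ℂ) ^ 2 * expCoeff a M m * hypCoeff a m n =
      (M.choose n : ℂ) := by
  induction M generalizing n with
  | zero =>
    rcases n.eq_zero_or_pos with rfl | hn
    · simpa using hypCoeff_self_mul_expCoeff a 0
    · simp [hypCoeff_eq_zero hn, Nat.choose_eq_zero_of_lt hn]
  | succ M ih =>
    rcases lt_or_ge (M + 1) n with hn | hn
    · rw [Nat.choose_eq_zero_of_lt hn, Nat.cast_zero]
      exact sum_eq_zero fun m hm => by
        rw [hypCoeff_eq_zero (by have := mem_range.1 hm; omega), mul_zero]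
    induction hn using Nat.decreasingInduction with
    | self =>
      rw [sum_range_succ, hypCoeff_self_mul_expCoeff, sum_eq_zero fun m hm => by
        rw [hypCoeff_eq_zero (by have := mem_range.1 hm; omega), mul_zero]]
      simp
    | of_succ n hn ihn =>
      have hn' : n < M + 1 := hn
      have hne : ((M : ℂ) + 1 - n) * (M + 1 + n + a + 1) ≠ 0 := by
        refine mul_ne_zero (sub_ne_zero.2 ?_) ?_
        · exact_mod_cast hn'.ne'
        · exact_mod_cast Nat.succ_ne_zero (M + 1 + n + a)
      refine mul_left_cancel₀ hne ?_
      -- Write `λ_{M+1} - λ_n = (λ_{M+1} - λ_m) + (λ_m - λ_n)` in each term: the first part lowers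
      -- `M` by `expCoeff_succ`, the second raises `n` by `hypCoeff_succ`.
      have hsplit : ((M : ℂ) + 1 - n) * (M + 1 + n + a + 1) *
          ∑ m ∈ range (M + 1 + 1), ((M + 1).factorial : ℂ) ^ 2 * expCoeff a (M + 1) m *
            hypCoeff a m n =
          ((M : ℂ) + 1) ^ 2 * ∑ m ∈ range (M + 1 + 1),
            (M.factorial : ℂ) ^ 2 * expCoeff a M m * hypCoeff a m n +
          (n + 1) * (a + 1 + n) * ∑ m ∈ range (M + 1 + 1),
            ((M + 1).factorial : ℂ) ^ 2 * expCoeff a (M + 1) m * hypCoeff a m (n + 1) := by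
        rw [mul_sum, mul_sum, mul_sum, ← sum_add_distrib]
        refine sum_congr rfl fun m _ => ?_
        have h1 := expCoeff_succ a M m
        have h2 := hypCoeff_succ a m n
        have h3 : ((M + 1).factorial : ℂ) = (M + 1) * (M.factorial : ℂ) := by
          rw [Nat.factorial_succ]
          push_cast
          ring
        rw [h3]
        linear_combination (-((M : ℂ) + 1) ^ 2 * (M.factorial : ℂ) ^ 2 * hypCoeff a m n) * (-h1) -
          ((M : ℂ) + 1) ^ 2 * (M.factorial : ℂ) ^ 2 * expCoeff a (M + 1) m * h2
      have hlast : expCoeff a M (M + 1) = 0 := by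
        simp [expCoeff]
      rw [hsplit, ihn, sum_range_succ, ih, hlast]
      have c1 : ((M : ℂ) + 1 - n) * ((M + 1).choose n : ℂ) = (M + 1) * (M.choose n : ℂ) := by
        have := Nat.choose_mul_succ_eq M n
        rw [← @Nat.cast_inj ℂ] at this
        push_cast [Nat.cast_sub hn'.le] at this
        linear_combination -this
      have c2 : ((n : ℂ) + 1) * ((M + 1).choose (n + 1) : ℂ) =
          (M + 1 - n) * ((M + 1).choose n : ℂ) := by
        have := Nat.choose_succ_right_eq (M + 1) n
        rw [← @Nat.cast_inj ℂ] at this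
        push_cast [Nat.cast_sub hn'.le] at this
        linear_combination this
      linear_combination (-((M : ℂ) + 1)) * c1 + ((a : ℂ) + 1 + n) * c2

/-- The bound `K` is free so that all the powers share one index set in Cauchy–Binet; terms with `m
> M` vanish. -/
theorem one_add_pow_eq_sum (a : ℕ) {M K : ℕ} (hK : M < K) (x : ℂ) :
    (1 + x) ^ M = ∑ m : Fin K,
      (M.factorial : ℂ) ^ 2 * expCoeff a M m * (hypPoly a m).eval x := by
  rw [Fin.sum_univ_eq_sum_range
    (fun m => (M.factorial : ℂ) ^ 2 * expCoeff a M m * (hypPoly a m).eval x),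
    ← sum_subset (range_subset_range.2 (Nat.succ_le_of_lt hK)) fun m _ hm => by
      rw [expCoeff, Nat.descFactorial_of_lt (by simpa using hm)]
      simp]
  have hpoly : ((1 : ℂ[X]) + X) ^ M = ∑ m ∈ range (M + 1),
      C ((M.factorial : ℂ) ^ 2 * expCoeff a M m) * hypPoly a m := by
    ext n
    rw [coeff_one_add_X_pow, finsetSum_coeff, ← sum_expCoeff_mul_hypCoeff a]
    simp only [coeff_C_mul, coeff_hypPoly]
  have := congrArg (eval x) hpoly
  simpa [eval_finsetSum] using this

/-! ### The determinants of the coefficients -/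

theorem det_prod_sub_eq_vandermonde {R : Type*} [CommRing R] {p : ℕ} (v : Fin p → R) (c : ℕ → R) :
    (Matrix.of fun i j : Fin p => ∏ u ∈ range j, (v i - c u)).det = (vandermonde v).det := by
  nontriviality R
  rw [det_eval_matrixOfPolynomials_eq_det_vandermonde v
    (fun i => ∏ u ∈ range i, (X - C (c u)))
    (fun i => by simp [natDegree_prod_of_monic _ _ fun u _ => monic_X_sub_C (c u)])
    (fun i => monic_prod_of_monic _ _ fun u _ => monic_X_sub_C _)]
  simp [eval_prod]

/-- The two reversal signs cancel. -/
theorem prod_sub_mul_prod_sub {p : ℕ} (x y : Fin p → ℂ) :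
    (∏ k, ∏ l ∈ Ioi k, (x k - x l)) * ∏ k, ∏ l ∈ Ioi k, (y k - y l) =
      (vandermonde x).det * (vandermonde y).det := by
  rw [det_vandermonde, det_vandermonde, ← prod_mul_distrib, ← prod_mul_distrib]
  refine prod_congr rfl fun k _ => ?_
  rw [← prod_mul_distrib, ← prod_mul_distrib]
  exact prod_congr rfl fun l _ => by ring

/-- The eigenvalue `m (m + a + 1)` of the Jacobi operator on the `m`-th hypergeometric
polynomial. -/
def jacobiEigenvalue (a m : ℕ) : ℂ := m * (m + a + 1)

theorem jacobiEigenvalue_sub (a m n : ℕ) :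
    jacobiEigenvalue a m - jacobiEigenvalue a n = ((m : ℂ) - n) * (m + n + a + 1) := by
  rw [jacobiEigenvalue, jacobiEigenvalue]
  ring

theorem jacobiEigenvalue_injective (a : ℕ) : Function.Injective (jacobiEigenvalue a) := by
  intro m n h
  rw [← sub_eq_zero, jacobiEigenvalue_sub, mul_eq_zero, sub_eq_zero] at h
  refine h.elim (fun h => by exact_mod_cast h) fun h => ?_
  exact absurd (by exact_mod_cast h) (Nat.succ_ne_zero (m + n + a))

theorem hypCoeff_eq_prod_div (a m n : ℕ) :
    hypCoeff a m n = ((n.factorial : ℂ) * (a + n).factorial / a.factorial)⁻¹ *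
      ∏ u ∈ range n, (jacobiEigenvalue a m - u * (a + 1 + u)) := by
  have hden : (n.factorial : ℂ) * (a + n).factorial / a.factorial =
      ∏ u ∈ range n, (((a : ℂ) + 1 + u) * (u + 1)) := by
    rw [div_eq_iff (by exact_mod_cast a.factorial_ne_zero)]
    induction n with
    | zero => simp
    | succ n ih =>
      rw [prod_range_succ, ← add_assoc, Nat.factorial_succ, Nat.factorial_succ]
      push_cast
      linear_combination ((a : ℂ) + 1 + n) * (n + 1) * ih
  rw [hden, hypCoeff, prod_div_distrib, div_eq_inv_mul]
  congr 1
  exact prod_congr rfl fun u _ => by rw [jacobiEigenvalue]; ring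

/-- The coefficient of `x ^ n` in `P_m` is a constant times a monic polynomial of degree `n` in
`λ_m`. -/
theorem det_hypCoeff {p : ℕ} (a : ℕ) (g : Fin p → ℕ) :
    (Matrix.of fun i j : Fin p => hypCoeff a (g j) i).det =
      (∏ i : Fin p, ((i : ℕ).factorial : ℂ) * (a + i).factorial / a.factorial)⁻¹ *
        (vandermonde fun j => jacobiEigenvalue a (g j)).det := by
  rw [← det_prod_sub_eq_vandermonde _ fun u => (u : ℂ) * (a + 1 + u), ← prod_inv_distrib,
    ← Matrix.det_transpose (Matrix.of fun i j : Fin p => ∏ u ∈ range (j : ℕ), _),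
    ← Matrix.det_mul_column]
  congr 1
  ext i j
  simp only [Matrix.of_apply, Matrix.transpose_apply]
  rw [hypCoeff_eq_prod_div]

theorem expCoeff_sub (a m M k : ℕ) (hk : k ≤ M) :
    expCoeff a (M - k) m = (∏ u ∈ range k,
      (-jacobiEigenvalue a m - -(((M : ℂ) - u) * (M - u + a + 1)))) * expCoeff a M m := by
  induction k with
  | zero => simp
  | succ k ih =>
    have h := expCoeff_succ a (M - (k + 1)) m
    rw [show M - (k + 1) + 1 = M - k by omega, ih (by omega)] at h
    rw [← h, prod_range_succ, Nat.cast_sub hk, jacobiEigenvalue]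
    push_cast
    ring

theorem det_expCoeff {p N : ℕ} (a : ℕ) (g : Fin p → ℕ) :
    (Matrix.of fun i j : Fin p => (((N + (i.rev : ℕ)).factorial : ℂ) ^ 2 *
      expCoeff a (N + (i.rev : ℕ)) (g j))).det =
      (∏ i : Fin p, ((N + (i : ℕ)).factorial : ℂ) ^ 2) *
        ((∏ j, expCoeff a (N + p - 1) (g j)) *
          ∏ k, ∏ l ∈ Ioi k, (((g k : ℂ) - g l) * (g k + g l + a + 1))) := by
  have hrev : ∏ i : Fin p, ((N + (i : ℕ)).factorial : ℂ) ^ 2 =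
      ∏ i : Fin p, ((N + (i.rev : ℕ)).factorial : ℂ) ^ 2 :=
    (Equiv.prod_comp Fin.revPerm fun i : Fin p => ((N + (i : ℕ)).factorial : ℂ) ^ 2).symm
  -- Using `-λ` as variable gives the order `k` minus `l` without a sign.
  have hvdm : ∏ k, ∏ l ∈ Ioi k, (((g k : ℂ) - g l) * (g k + g l + a + 1)) =
      (vandermonde fun j => -jacobiEigenvalue a (g j)).det := by
    rw [det_vandermonde]
    refine prod_congr rfl fun k _ => prod_congr rfl fun l _ => ?_
    rw [← jacobiEigenvalue_sub]
    ring
  rw [hrev, hvdm, ← det_prod_sub_eq_vandermonde _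
    fun u => -((((N + p - 1 : ℕ) : ℂ) - u) * ((N + p - 1 : ℕ) - u + a + 1)),
    ← Matrix.det_transpose (Matrix.of fun i j : Fin p => ∏ u ∈ range (j : ℕ), _),
    ← Matrix.det_mul_row, ← Matrix.det_mul_column]
  congr 1
  ext i j
  simp only [Matrix.of_apply, Matrix.transpose_apply]
  have hi : N + (i.rev : ℕ) = N + p - 1 - i := by
    rw [Fin.val_rev]
    omega
  have h := expCoeff_sub a (g j) (N + p - 1) i (by omega)
  rw [← hi] at h
  rw [h]
  ring

/-! ### The expansion into determinants -/

theorem det_one_add_pow_rev {p : ℕ} (N : ℕ) (x : Fin p → ℂ) :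
    (Matrix.of fun i l : Fin p => (1 + x l) ^ (N + (i.rev : ℕ))).det =
      (∏ j, (1 + x j) ^ N) * ∏ k, ∏ l ∈ Ioi k, (x k - x l) := by
  have h : ∏ k, ∏ l ∈ Ioi k, (x k - x l) = (projVandermonde 1 fun i => 1 + x i).det := by
    rw [det_projVandermonde]
    exact prod_congr rfl fun k _ => prod_congr rfl fun l _ => by simp
  rw [h, ← Matrix.det_transpose, ← Matrix.det_mul_column]
  congr 1
  ext l i
  simp [projVandermonde_apply, pow_add]

theorem prod_one_add_pow_mul_prod_sub {p : ℕ} (a N : ℕ) (x : Fin p → ℂ) :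
    (∏ j, (1 + x j) ^ N) * ∏ k, ∏ l ∈ Ioi k, (x k - x l) =
      (∏ i : Fin p, ((N + (i : ℕ)).factorial : ℂ) ^ 2) *
        ∑ m : Fin p → Fin (N + p) with StrictAnti m,
          (∏ j, expCoeff a (N + p - 1) (m j)) *
            (∏ k, ∏ l ∈ Ioi k,
              ((((m k : ℕ) : ℂ) - (m l : ℕ)) * ((m k : ℕ) + (m l : ℕ) + a + 1))) *
            (Matrix.of fun j l : Fin p => (hypPoly a (m j)).eval (x l)).det := by
  have hmul : (Matrix.of fun i l : Fin p => (1 + x l) ^ (N + (i.rev : ℕ))) =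
      (Matrix.of fun (i : Fin p) (m : Fin (N + p)) => ((N + (i.rev : ℕ)).factorial : ℂ) ^ 2 *
        expCoeff a (N + (i.rev : ℕ)) m) *
      (Matrix.of fun (m : Fin (N + p)) (l : Fin p) => (hypPoly a m).eval (x l)) := by
    ext i l
    rw [Matrix.mul_apply, Matrix.of_apply,
      one_add_pow_eq_sum a (Nat.add_lt_add_left i.rev.isLt N)]
    rfl
  rw [← det_one_add_pow_rev, hmul, Matrix.det_mul_eq_sum_strictAnti, mul_sum]
  refine sum_congr rfl fun m _ => ?_
  rw [← mul_assoc, ← det_expCoeff a fun j => (m j : ℕ)]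
  rfl

/-! ### The spherical functions -/

theorem dense_injective {p : ℕ} : Dense {x : Fin p → ℂ | Function.Injective x} := by
  have h : {x : Fin p → ℂ | Function.Injective x} =
      ⋂ ij : {ij : Fin p × Fin p // ij.1 ≠ ij.2}, {x : Fin p → ℂ | x ij.1.1 = x ij.1.2}ᶜ := by
    ext x
    simp only [Set.mem_iInter, Set.mem_compl_iff, Set.mem_ofPred_eq]
    exact ⟨fun hx ij h => ij.2 (hx h), fun hx i j hij => by
      by_contra hne
      exact hx ⟨(i, j), hne⟩ hij⟩
  rw [h]
  -- Baire: each `x_i ≠ x_j` is an open condition, and dense because `x_i - x_j` is an open map.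
  refine dense_iInter_of_isOpen (fun ij => ?_) fun ij => ?_
  · exact (isClosed_eq (continuous_apply ij.1.1) (continuous_apply ij.1.2)).isOpen_compl
  · let f : (Fin p → ℂ) →L[ℂ] ℂ :=
      ContinuousLinearMap.proj (R := ℂ) (φ := fun _ : Fin p => ℂ) ij.1.1 -
        ContinuousLinearMap.proj (R := ℂ) (φ := fun _ : Fin p => ℂ) ij.1.2
    have hf : {x : Fin p → ℂ | x ij.1.1 = x ij.1.2}ᶜ = f ⁻¹' {0}ᶜ := by
      ext x
      simp [f, sub_eq_zero]
    rw [hf]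
    refine (dense_compl_singleton 0).preimage (f.isOpenMap fun c => ⟨Pi.single ij.1.1 c, ?_⟩)
    simp [f, ij.2.symm]

theorem sphericalPhi_eq {p : ℕ} (a : ℕ) (g : Fin p → ℕ) (hg : Function.Injective g)
    (x : Fin p → ℂ) :
    sphericalPhi p (p + a) (fun j => (p : ℂ) - hParam p (p + a) - g j - 1) x =
      (∏ i : Fin p, ((i : ℕ).factorial : ℂ) * (a + i).factorial / a.factorial) *
        (dividedDifferenceDet (fun j => hypPoly a (g j)) x /
          (vandermonde fun j => jacobiEigenvalue a (g j)).det) := by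
  set s : Fin p → ℂ := fun j => (p : ℂ) - hParam p (p + a) - g j - 1 with hs
  have hμ : (vandermonde fun j => jacobiEigenvalue a (g j)).det ≠ 0 :=
    det_vandermonde_ne_zero_iff.2 ((jacobiEigenvalue_injective a).comp hg)
  -- Here `s_j = -(r + g j)`, so `s_j ^ 2 = λ_{g j} + r ^ 2`.
  have hsq : ∏ k, ∏ l ∈ Ioi k, (s k ^ 2 - s l ^ 2) =
      ∏ k, ∏ l ∈ Ioi k, (jacobiEigenvalue a (g k) - jacobiEigenvalue a (g l)) := by
    refine prod_congr rfl fun k _ => prod_congr rfl fun l _ => ?_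
    simp only [hs, hParam, jacobiEigenvalue]
    push_cast
    ring
  have hF : ∀ (j : Fin p) (z : ℂ), ₂F₁ (rParam p (p + a) + s j) (rParam p (p + a) - s j)
      (((p + a : ℕ) : ℂ) - p + 1) (-z) = (hypPoly a (g j)).eval z := fun j z => by
    have h1 : rParam p (p + a) + s j = -(g j : ℂ) := by
      simp only [hs, hParam, rParam]
      push_cast
      ring
    have h2 : rParam p (p + a) - s j = (a : ℂ) + 1 + g j := by
      simp only [hs, hParam, rParam]
      push_cast
      ring
    have h3 : ((p + a : ℕ) : ℂ) - p + 1 = a + 1 := by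
      push_cast
      ring
    rw [h1, h2, h3, hypergeometric_eq_eval_hypPoly]
  have hBK : ∀ y, berezinKarpelevich p (p + a) s y =
      dividedDifferenceDet (fun j => hypPoly a (g j)) y /
        (vandermonde fun j => jacobiEigenvalue a (g j)).det := fun y => by
    refine extendFrom_eq (dense_injective y) ?_
    refine Filter.Tendsto.congr' ?_
      (((continuous_dividedDifferenceDet fun j => hypPoly a (g j)).div_const _).tendsto y
        |>.mono_left nhdsWithin_le_nhds)
    filter_upwards [self_mem_nhdsWithin] with z hz
    have hz' : (vandermonde z).det ≠ 0 := det_vandermonde_ne_zero_iff.2 hz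
    rw [berezinKarpelevichQuotient, hsq, prod_sub_mul_prod_sub]
    simp only [hF]
    rw [det_eval_eq_vandermonde_mul]
    field_simp
  have hprod : (∏ i : Fin p, ((i : ℕ).factorial : ℂ) * (a + i).factorial / a.factorial) ≠ 0 :=
    prod_ne_zero_iff.2 fun i _ => div_ne_zero (mul_ne_zero
      (by exact_mod_cast Nat.factorial_ne_zero _) (by exact_mod_cast Nat.factorial_ne_zero _))
      (by exact_mod_cast a.factorial_ne_zero)
  rw [sphericalPhi, hBK, hBK, dividedDifferenceDet_zero]
  simp only [coeff_hypPoly]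
  rw [det_hypCoeff]
  field_simp

theorem det_hypPoly_eq_mul_sphericalPhi {p : ℕ} (a : ℕ) (g : Fin p → ℕ)
    (hg : Function.Injective g) (x : Fin p → ℂ) :
    (∏ i : Fin p, ((i : ℕ).factorial : ℂ) * (a + i).factorial / a.factorial) *
      (Matrix.of fun j l : Fin p => (hypPoly a (g j)).eval (x l)).det =
      (∏ k, ∏ l ∈ Ioi k, (((g k : ℂ) - g l) * (g k + g l + a + 1))) *
        (∏ k, ∏ l ∈ Ioi k, (x k - x l)) *
        sphericalPhi p (p + a) (fun j => (p : ℂ) - hParam p (p + a) - g j - 1) x := by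
  have hμ : (vandermonde fun j => jacobiEigenvalue a (g j)).det ≠ 0 :=
    det_vandermonde_ne_zero_iff.2 ((jacobiEigenvalue_injective a).comp hg)
  have hdet : (Matrix.of fun j l : Fin p => (hypPoly a (g j)).eval (x l)).det =
      (vandermonde x).det * dividedDifferenceDet (fun j => hypPoly a (g j)) x := by
    rw [← det_eval_eq_vandermonde_mul, ← Matrix.det_transpose]
    rfl
  simp only [← jacobiEigenvalue_sub]
  rw [prod_sub_mul_prod_sub, sphericalPhi_eq a g hg, hdet]
  field_simp

theorem continuous_sphericalPhi {p : ℕ} (a : ℕ) (g : Fin p → ℕ) (hg : Function.Injective g) :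
    Continuous (sphericalPhi p (p + a) fun j => (p : ℂ) - hParam p (p + a) - g j - 1) := by
  rw [funext (sphericalPhi_eq a g hg)]
  exact continuous_const.mul ((continuous_dividedDifferenceDet _).div_const _)

/-! ### The normalizing constants -/

theorem coeffFactor_eq (p a N m : ℕ) (hm : m < N + p) :
    coeffFactor p (p + a) N m = a.factorial * expCoeff a (N + p - 1) m := by
  -- Here `N + p - m = d + 1`, so the last Gamma value is `d!` and no pole occurs.
  obtain ⟨d, hd⟩ := Nat.exists_eq_add_of_lt hm
  have h1 : Complex.Gamma ((N : ℂ) + (p + a : ℕ) + m + 1) = (a + m + (N + p - 1) + 1).factorial := by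
    rw [← Complex.Gamma_nat_eq_factorial, show a + m + (N + p - 1) + 1 = N + (p + a) + m by omega]
    push_cast
    rfl
  have h2 : Complex.Gamma ((N : ℂ) + p - m) = d.factorial := by
    rw [← Complex.Gamma_nat_eq_factorial]
    congr 1
    have : (N : ℂ) + p = m + d + 1 := by exact_mod_cast hd
    rw [this]
    ring
  have h3 : ((m + d).descFactorial m : ℂ) * d.factorial = (m + d).factorial := by
    have := Nat.factorial_mul_descFactorial (Nat.le_add_right m d)
    rw [Nat.add_sub_cancel_left, mul_comm] at this
    exact_mod_cast this
  have hf : ∀ n : ℕ, (n.factorial : ℂ) ≠ 0 := fun n => by exact_mod_cast n.factorial_ne_zero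
  have := hf a
  have := hf m
  have := hf d
  have := hf (m + d)
  rw [coeffFactor, expCoeff, h1, h2, show p + a - p + m = a + m by omega,
    show N + p - 1 = m + d by omega]
  have := hf (a + m + (m + d) + 1)
  push_cast
  field_simp
  linear_combination -(2 * (m : ℂ) + a + 1) * ((a + m).factorial : ℂ) ^ 2 * h3

theorem prod_Icc_eq_prod_fin (p : ℕ) (f : ℕ → ℂ) :
    ∏ j ∈ Icc 1 p, f j = ∏ i : Fin p, f (i + 1) := by
  rw [Fin.prod_univ_eq_prod_range (fun i => f (i + 1)), Finset.range_eq_Ico,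
    prod_Ico_add' f 0 p 1]
  rfl

theorem Gamma_add_eq_factorial (N i : ℕ) :
    Complex.Gamma ((N : ℂ) + (i + 1 : ℕ)) = (N + i).factorial := by
  rw [← Complex.Gamma_nat_eq_factorial]
  push_cast
  ring_nf

theorem prod_coeffFactor {p N : ℕ} (a : ℕ) (m : Fin p → Fin (N + p)) :
    ∏ j, coeffFactor p (p + a) N (m j) =
      (a.factorial : ℂ) ^ p * ∏ j, expCoeff a (N + p - 1) (m j) := by
  simp only [fun j => coeffFactor_eq p a N (m j) (m j).isLt, prod_mul_distrib, prod_const,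
    card_univ, Fintype.card_fin]

theorem prod_one_add_pow_mul_prod_sub_eq_sum_det (p a N : ℕ) (x : Fin p → ℂ) :
    (∏ j, (1 + x j) ^ N) * ∏ k, ∏ l ∈ Ioi k, (x k - x l) =
      (∏ j ∈ Icc 1 p, Complex.Gamma ((N : ℂ) + j) ^ 2) /
          Complex.Gamma (((p + a : ℕ) : ℂ) - p + 1) ^ p *
        ∑ m : Fin p → Fin (N + p) with StrictAnti m,
          (∏ j, coeffFactor p (p + a) N (m j)) *
            (∏ k, ∏ l ∈ Ioi k,
              (((m k : ℕ) : ℂ) - (m l : ℕ)) *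
                ((m k : ℕ) + (m l : ℕ) + (p + a : ℕ) - p + 1)) *
            (Matrix.of fun j l : Fin p =>
              ₂F₁ (-((m j : ℕ) : ℂ)) (((p + a : ℕ) : ℂ) - p + 1 + (m j : ℕ))
                (((p + a : ℕ) : ℂ) - p + 1) (-x l)).det := by
  have hq : ((p + a : ℕ) : ℂ) - p = a := by
    push_cast
    ring
  have ha : (a.factorial : ℂ) ≠ 0 := by exact_mod_cast a.factorial_ne_zero
  simp only [prod_Icc_eq_prod_fin p fun j => Complex.Gamma ((N : ℂ) + j) ^ 2,
    Gamma_add_eq_factorial, add_sub_assoc, hq, Complex.Gamma_nat_eq_factorial,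
    hypergeometric_eq_eval_hypPoly, prod_coeffFactor]
  rw [prod_one_add_pow_mul_prod_sub a, div_mul_eq_mul_div, mul_div_assoc, sum_div]
  congr 1
  refine sum_congr rfl fun m _ => ?_
  field_simp

theorem prod_one_add_pow_eq_sum_sphericalPhi (p a N : ℕ) (x : Fin p → ℂ) :
    ∏ j, (1 + x j) ^ N =
      (∏ j ∈ Icc 1 p, Complex.Gamma ((N : ℂ) + j) ^ 2 /
          (Complex.Gamma (j : ℂ) * Complex.Gamma (((p + a : ℕ) : ℂ) - p + j))) *
        ∑ m : Fin p → Fin (N + p) with StrictAnti m,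
          (∏ j, coeffFactor p (p + a) N (m j)) *
            (∏ k, ∏ l ∈ Ioi k,
              (((m k : ℕ) : ℂ) - (m l : ℕ)) ^ 2 *
                ((m k : ℕ) + (m l : ℕ) + (p + a : ℕ) - p + 1) ^ 2) *
            sphericalPhi p (p + a) (fun j => (p : ℂ) - hParam p (p + a) - (m j : ℕ) - 1) x := by
  have hf : ∀ n : ℕ, (n.factorial : ℂ) ≠ 0 := fun n => by exact_mod_cast n.factorial_ne_zero
  have hinj : ∀ m ∈ (univ : Finset (Fin p → Fin (N + p))).filter StrictAnti,
      Function.Injective fun j => (m j : ℕ) := fun m hm =>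
    Fin.val_injective.comp (mem_filter.1 hm).2.injective
  revert x
  rw [← funext_iff]
  -- Both sides are continuous, so distinct coordinates suffice and the Vandermonde product can be
  -- cancelled.
  refine Continuous.ext_on dense_injective (by fun_prop)
    (continuous_const.mul (continuous_finsetSum _ fun m hm => continuous_const.mul
      (continuous_sphericalPhi a _ (hinj m hm)))) fun x hx => ?_
  have hV : ∏ k, ∏ l ∈ Ioi k, (x k - x l) ≠ 0 := fun h => by
    have := prod_sub_mul_prod_sub x x
    rw [h, zero_mul] at this
    exact (mul_ne_zero_iff.2 ⟨det_vandermonde_ne_zero_iff.2 hx, det_vandermonde_ne_zero_iff.2 hx⟩)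
      this.symm
  refine mul_right_cancel₀ hV ?_
  have hq : ((p + a : ℕ) : ℂ) - p = a := by
    push_cast
    ring
  have hΓ : ∀ i : ℕ, Complex.Gamma ((i + 1 : ℕ) : ℂ) = i.factorial := fun i => by
    rw [← Complex.Gamma_nat_eq_factorial, Nat.cast_add_one]
  have hconst : (∏ i : Fin p, ((N + (i : ℕ)).factorial : ℂ) ^ 2 /
      ((i : ℕ).factorial * (a + i).factorial)) * (a.factorial : ℂ) ^ p *
      (∏ i : Fin p, ((i : ℕ).factorial : ℂ) * (a + i).factorial / a.factorial) =
      ∏ i : Fin p, ((N + (i : ℕ)).factorial : ℂ) ^ 2 := by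
    have hpow : (a.factorial : ℂ) ^ p = ∏ _i : Fin p, (a.factorial : ℂ) := by simp
    rw [hpow, ← prod_mul_distrib, ← prod_mul_distrib]
    refine prod_congr rfl fun i _ => ?_
    have := hf a
    have := hf i
    have := hf (a + i)
    field_simp
  have hpre : ∏ j ∈ Icc 1 p, Complex.Gamma ((N : ℂ) + j) ^ 2 /
      (Complex.Gamma (j : ℂ) * Complex.Gamma (((p + a : ℕ) : ℂ) - p + j)) =
      ∏ i : Fin p, ((N + (i : ℕ)).factorial : ℂ) ^ 2 /
        ((i : ℕ).factorial * (a + i).factorial) := by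
    rw [prod_Icc_eq_prod_fin p fun j => Complex.Gamma ((N : ℂ) + j) ^ 2 /
      (Complex.Gamma (j : ℂ) * Complex.Gamma (((p + a : ℕ) : ℂ) - p + j)), hq]
    simp only [Gamma_add_eq_factorial, hΓ]
  rw [prod_one_add_pow_mul_prod_sub a, ← hconst, hpre]
  simp only [hq, add_sub_assoc, prod_coeffFactor, ← mul_pow, prod_pow]
  rw [mul_assoc, mul_assoc, mul_assoc, mul_sum, mul_sum, sum_mul]
  congr 1
  refine sum_congr rfl fun m hm => ?_
  have h := det_hypPoly_eq_mul_sphericalPhi a (fun j => (m j : ℕ)) (hinj m hm) x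
  linear_combination ((a.factorial : ℂ) ^ p * (∏ j, expCoeff a (N + p - 1) (m j)) *
    ∏ k, ∏ l ∈ Ioi k, ((((m k : ℕ) : ℂ) - (m l : ℕ)) * ((m k : ℕ) + (m l : ℕ) + a + 1))) * h
end

theorem theorem9p1 (p q N : ℕ) (hpq : p ≤ q) (x : Fin p → ℂ) :
    ((∏ j, (1 + x j) ^ N) * ∏ k, ∏ l ∈ Finset.Ioi k, (x k - x l) =
      (∏ j ∈ Finset.Icc 1 p, Complex.Gamma ((N : ℂ) + j) ^ 2) /
          Complex.Gamma ((q : ℂ) - p + 1) ^ p *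
        ∑ m : Fin p → Fin (N + p) with StrictAnti m,
          (∏ j, coeffFactor p q N (m j)) *
            (∏ k, ∏ l ∈ Finset.Ioi k,
              (((m k : ℕ) : ℂ) - (m l : ℕ)) * ((m k : ℕ) + (m l : ℕ) + q - p + 1)) *
            (Matrix.of fun j l : Fin p =>
              ₂F₁ (-((m j : ℕ) : ℂ)) ((q : ℂ) - p + 1 + (m j : ℕ)) ((q : ℂ) - p + 1) (-x l)).det) ∧
    (∏ j, (1 + x j) ^ N =
      (∏ j ∈ Finset.Icc 1 p, Complex.Gamma ((N : ℂ) + j) ^ 2 /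
          (Complex.Gamma (j : ℂ) * Complex.Gamma ((q : ℂ) - p + j))) *
        ∑ m : Fin p → Fin (N + p) with StrictAnti m,
          (∏ j, coeffFactor p q N (m j)) *
            (∏ k, ∏ l ∈ Finset.Ioi k,
              (((m k : ℕ) : ℂ) - (m l : ℕ)) ^ 2 * ((m k : ℕ) + (m l : ℕ) + q - p + 1) ^ 2) *
            sphericalPhi p q (fun j => (p : ℂ) - hParam p q - (m j : ℕ) - 1) x) := by
  obtain ⟨a, rfl⟩ := Nat.exists_eq_add_of_le hpq
  exact ⟨prod_one_add_pow_mul_prod_sub_eq_sum_det p a N x,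
    prod_one_add_pow_eq_sum_sphericalPhi p a N x⟩
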